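/- \textbf{Theorem (nonanticipative RDF of BSMS($p$)).} Let $p\in[0,1]$ and $D\ge 0$. Let $\{X_i\}_{i\ge0}$ be the stationary binary symmetric Markov source with parameter $p$: $X_0$ is uniform on $\{0,1\}$ and $P(X_{i+1}=b\mid X_i=a)=1-p$ if $a=b$ and $=p$ if $a\ne b$. Let $\rho(x,y)=0$ if $x=y$ and $\rho(x,y)=1$ if $x\neq y$. A \emph{causal reproduction distribution} is a sequence $Q=\{Q_i(y_i\mid y^{i-1},x^i)\}_{i\ge0}$ of conditional probability distributions on $\{0,1\}$, where $x^i=(x_0,\dots,x_i)$ and $y^{i-1}=(y_0,\dots,y_{i-1})$. With $\overrightarrow Q(y^n\mid x^n)=\prod_{i=0}^n Q_i(y_i\mid y^{i-1},x^i)$, the joint law of $(X^n,Y^n)$ is $P_{X^n}(x^n)\overrightarrow Q(y^n\mid x^n)$. Write $P_{Y^n}$ for its $Y^n$-marginal and put $$\mathbb I_n(Q)=\mathbb E\Big[\log_2\frac{\overrightarrow Q(Y^n\mid X^n)}{P_{Y^n}(Y^n)}\Big],\qquad d_n(Q)=\frac1{n+1}\,\mathbb E\Big[\sum_{i=0}^n\rho(X_i,Y_i)\Big].$$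 Define $$R^{na}_{0,n}(D)=\inf\{\mathbb I_n(Q): d_n(Q)\le D\},\qquad R^{na}(D)=\lim_{n\to\infty}\frac1{n+1}R^{na}_{0,n}(D).$$ Let $H(q)=-q\log_2q-(1-q)\log_2(1-q)$ be the binary entropy function and $m=1-p-D+2pD$. (a) The limit $R^{na}(D)$ exists, and $R^{na}(D)=H(m)-H(D)$ if $D\le\frac12$, and $R^{na}(D)=0$ otherwise. (b) Let $D\le\frac12$, $\alpha=\frac{(1-p)(1-D)}{1-p-D+2pD}$ and $\beta=\frac{p(1-D)}{p+D-2pD}$ (a quotient with denominator $0$, which occurs only for $D=0$ and $p\in\{0,1\}$, is read as $0$). Let $Q^*$ have the initial kernel $Q^*_0(y_0\mid x_0)=1-D$ if $y_0=x_0$ and $=D$ if $y_0\ne x_0$, and for every $i\ge1$ the kernel $Q^*(y_i\mid y_{i-1},x_i)$ given by the matrix $$\begin{pmatrix}\alpha&1-\beta&\beta&1-\alpha\\ 1-\alpha&\beta&1-\beta&\alpha\end{pmatrix}$$ with rows $y_i=0,1$ and columns $(y_{i-1},x_i)=(0,0),(0,1),(1,0),(1,1)$. Then $Q^*$ is a causal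 reproduction distribution, the joint process $\{(X_i,Y_i)\}$ under $Q^*$ is stationary, and $Q^*$ is optimal: $d_n(Q^*)=D$ for all $n$ and $\lim_{n\to\infty}\frac1{n+1}\mathbb I_n(Q^*)=R^{na}(D)$, while $\liminf_{n\to\infty}\frac1{n+1}\mathbb I_n(Q)\ge R^{na}(D)$ for every causal reproduction distribution $Q$ such that $\lim_{n\to\infty}d_n(Q)$ exists and is at most $D$. (c) For $D\le\frac12$, under $Q^*$ the reproduction process $\{Y_i\}$ is a first-order Markov process with the same transition law as the source: for all $n$ and all $y_0,\dots,y_{n+1}$, $P_{Y^{n+1}}(y^{n+1})=P_{Y^n}(y^n)\cdot\big((1-p)\text{ if }y_{n+1}=y_n,\ p\text{ if }y_{n+1}\neq y_n\big)$. -/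

import Mathlib

noncomputable section

namespace NRDF

/-- A causal reproduction distribution on finite alphabets: a collection of conditional
probability mass functions `Q_{Y_i | Y^{i-1}, X^i}(b | y^{i-1}, x^i)`, one for each time
`i = 0, 1, 2, …`. The past `y^{i-1} = (y_0, …, y_{i-1})` is a tuple indexed by `Fin i`, and
`x^i = (x_0, …, x_i)` is a tuple indexed by `Fin (i + 1)`. -/
structure CausalKernel (X Y : Type) [Fintype Y] where
  /-- `prob i y x b` is `Q_{Y_i | Y^{i-1}, X^i}(b | y, x)`. -/
  prob : (i : ℕ) → (Fin i → Y) → (Fin (i + 1) → X) → Y → ℝ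
  nonneg : ∀ (i : ℕ) (y : Fin i → Y) (x : Fin (i + 1) → X) (b : Y), 0 ≤ prob i y x b
  sum_eq_one : ∀ (i : ℕ) (y : Fin i → Y) (x : Fin (i + 1) → X), ∑ b, prob i y x b = 1

section General

variable {X Y : Type} [Fintype X] [Fintype Y]

/-- The causally conditioned law of `y^n` given `x^n`: the product over `i = 0, …, n` of
`Q_{Y_i | Y^{i-1}, X^i}(y_i | y^{i-1}, x^i)`. -/
def CausalKernel.causalProb (Q : CausalKernel X Y) (n : ℕ)
    (x : Fin (n + 1) → X) (y : Fin (n + 1) → Y) : ℝ :=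
  ∏ i : Fin (n + 1),
    Q.prob i (fun j : Fin (i : ℕ) => y (Fin.castLE i.isLt.le j))
      (fun j : Fin ((i : ℕ) + 1) => x (Fin.castLE i.isLt j)) (y i)

/-- The joint law of `(X^n, Y^n)`. Here `P n` is the probability mass function of `X^n`. -/
def jointLaw (P : (n : ℕ) → (Fin (n + 1) → X) → ℝ) (Q : CausalKernel X Y) (n : ℕ)
    (x : Fin (n + 1) → X) (y : Fin (n + 1) → Y) : ℝ :=
  P n x * Q.causalProb n x y

/-- The marginal law of `Y^n`. -/
def reproductionLaw (P : (n : ℕ) → (Fin (n + 1) → X) → ℝ) (Q : CausalKernel X Y) (n : ℕ)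
    (y : Fin (n + 1) → Y) : ℝ :=
  ∑ x, jointLaw P Q n x y

/-- The information functional `𝕀_{X^n → Y^n}(P_{X^n}, Q)` in bits: the expectation, under the
joint law, of `log₂ (Q(y^n | x^n) / P_{Y^n}(y^n))`. Wherever the joint law is positive, so are
the numerator and the denominator. -/
def information (P : (n : ℕ) → (Fin (n + 1) → X) → ℝ) (Q : CausalKernel X Y) (n : ℕ) : ℝ :=
  ∑ x, ∑ y, jointLaw P Q n x y *
    Real.logb 2 (Q.causalProb n x y / reproductionLaw P Q n y)

/-- The average distortion `(1/(n+1)) E[∑_{i=0}^n ρ(X_i, Y_i)]`. -/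
def avgDistortion (P : (n : ℕ) → (Fin (n + 1) → X) → ℝ) (ρ : X → Y → ℝ)
    (Q : CausalKernel X Y) (n : ℕ) : ℝ :=
  (∑ x, ∑ y, jointLaw P Q n x y * ∑ i, ρ (x i) (y i)) / ((n : ℝ) + 1)

/-- The fidelity set for the horizon `n` and the distortion level `D`. -/
def fidelitySet (P : (n : ℕ) → (Fin (n + 1) → X) → ℝ) (ρ : X → Y → ℝ) (n : ℕ) (D : ℝ) :
    Set (CausalKernel X Y) :=
  {Q | avgDistortion P ρ Q n ≤ D}

/-- The infinite-horizon fidelity set: the limit of the average distortions is at most `D`. -/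
def fidelitySetInfinite (P : (n : ℕ) → (Fin (n + 1) → X) → ℝ) (ρ : X → Y → ℝ) (D : ℝ) :
    Set (CausalKernel X Y) :=
  {Q | ∃ d ≤ D, Filter.Tendsto (fun n => avgDistortion P ρ Q n) Filter.atTop (nhds d)}

/-- The information nonanticipative rate distortion function `R^{na}_{0,n}(D)` in bits; it is
`+∞` if no reproduction distribution has average distortion at most `D`. -/
def nonanticipativeRDF (P : (n : ℕ) → (Fin (n + 1) → X) → ℝ) (ρ : X → Y → ℝ) (n : ℕ) (D : ℝ) :
    EReal :=
  ⨅ Q ∈ fidelitySet P ρ n D, ((information P Q n : ℝ) : EReal)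

/-- `R^{na}(D)` exists and equals `R`: the sequence `R^{na}_{0,n}(D) / (n+1)` converges to `R`. -/
def HasNonanticipativeRate (P : (n : ℕ) → (Fin (n + 1) → X) → ℝ) (ρ : X → Y → ℝ) (D R : ℝ) :
    Prop :=
  Filter.Tendsto (fun n : ℕ => nonanticipativeRDF P ρ n D / (((n : ℝ) + 1 : ℝ) : EReal))
    Filter.atTop (nhds (R : EReal))

/-- The joint process `(X_i, Y_i)` is stationary: for every `n`, the vectors
`((X_1, Y_1), …, (X_{n+1}, Y_{n+1}))` and `((X_0, Y_0), …, (X_n, Y_n))` have the same law. -/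
def JointlyStationary (P : (n : ℕ) → (Fin (n + 1) → X) → ℝ) (Q : CausalKernel X Y) : Prop :=
  ∀ (n : ℕ) (x : Fin (n + 1) → X) (y : Fin (n + 1) → Y),
    ∑ a, ∑ b, jointLaw P Q (n + 1) (Fin.cons a x) (Fin.cons b y) = jointLaw P Q n x y

end General

/-- The transition probabilities of the binary symmetric Markov source with parameter `p`:
`bsmsTransition p a b` is the probability of moving from `a` to `b`. -/
def bsmsTransition (p : ℝ) (a b : Fin 2) : ℝ :=
  if a = b then 1 - p else p

/-- The law of `X^n = (X_0, …, X_n)` for the stationary binary symmetric Markov source with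
parameter `p`: `X_0` is uniform on `{0, 1}`. -/
def bsmsLaw (p : ℝ) (n : ℕ) (x : Fin (n + 1) → Fin 2) : ℝ :=
  1 / 2 * ∏ i : Fin n, bsmsTransition p (x i.castSucc) (x i.succ)

/-- The single-letter Hamming distortion. -/
def hamming (a b : Fin 2) : ℝ :=
  if a = b then 0 else 1

/-- The binary entropy function in bits. -/
def H (q : ℝ) : ℝ :=
  Real.binEntropy q / Real.log 2

/-- `m = 1 - p - D + 2pD`. -/
def mParam (p D : ℝ) : ℝ :=
  1 - p - D + 2 * p * D

/-- `α = (1-p)(1-D) / (1-p-D+2pD)`. -/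
def alpha (p D : ℝ) : ℝ :=
  (1 - p) * (1 - D) / (1 - p - D + 2 * p * D)

/-- `β = p(1-D) / (p+D-2pD)`. -/
def beta (p D : ℝ) : ℝ :=
  p * (1 - D) / (p + D - 2 * p * D)

/-- The kernel `Q*(y_i | y_{i-1}, x_i)`; the arguments are `y_{i-1}`, `x_i` and `y_i`, in this
order. It is the matrix with rows `y_i = 0, 1` and columns `(y_{i-1}, x_i) = 00, 01, 10, 11`
whose first row is `α, 1-β, β, 1-α` and whose second row is `1-α, β, 1-β, α`. -/
def optimalKernel (p D : ℝ) : Fin 2 → Fin 2 → Fin 2 → ℝ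
  | 0, 0, 0 => alpha p D
  | 0, 1, 0 => 1 - beta p D
  | 1, 0, 0 => beta p D
  | 1, 1, 0 => 1 - alpha p D
  | 0, 0, 1 => 1 - alpha p D
  | 0, 1, 1 => beta p D
  | 1, 0, 1 => 1 - beta p D
  | 1, 1, 1 => alpha p D

end NRDF

end

noncomputable section

namespace NRDF

/-! ### Causal kernels and the variational bound on information. -/

section General

variable {X Y : Type} [Fintype Y]

/-! Both bounds come from the backward test channel, in which `X_i` is `Y_i` passed through a binary
symmetric channel with crossover `δ`. Given `y_i`, the next source letter then differs from `y_i`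
with probability `r = p + δ - 2pδ`. The ratio of these two channel laws, multiplied over time, is a
likelihood ratio (`logRatio`) that integrates to one against the source law for every fixed `y`.

Converse: by Gibbs' inequality (`sum_jointLaw_mul_log_le`) the expected `logRatio` bounds the
information of any `Q` from below. That expectation depends on `Q` only through the mismatch
probabilities `e_i`, and affinely (`expect_logRatio`). The slope is nonpositive for `δ ≤ 1/2`, so
average distortion at most `δ` yields `h(r) - h(δ)` per letter up to a bounded error, with `h` the
entropy in nats. The logarithms need `δ > 0`, so `D` is approached from above and continuity of the
rate closes the gap.

Achievability: Bayes' rule (`bsmsTransition_mul_optimalKernel`) says that `Q*` is the forward form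
of this channel with `δ = D`. Hence `Y` has the law of the source, each mismatch probability is `D`,
and the variational bound is attained. -/

lemma sum_fin_snoc {α M : Type*} [Fintype α] [AddCommMonoid M] (n : ℕ)
    (F : (Fin (n + 1) → α) → M) :
    ∑ x, F x = ∑ x : Fin n → α, ∑ a, F (Fin.snoc x a) := by
  rw [← (Fin.snocEquiv fun _ : Fin (n + 1) => α).sum_comp, Fintype.sum_prod_type_right]
  rfl

lemma causalProb_snoc (Q : CausalKernel X Y) (n : ℕ) (x : Fin (n + 1) → X) (a : X)
    (y : Fin (n + 1) → Y) (b : Y) :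
    Q.causalProb (n + 1) (Fin.snoc x a) (Fin.snoc y b) =
      Q.causalProb n x y * Q.prob (n + 1) y (Fin.snoc x a) b := by
  have h : ∀ (x' : Fin (n + 2) → X) (y' : Fin (n + 2) → Y),
      Q.causalProb (n + 1) x' y' =
        Q.causalProb n (fun j => x' j.castSucc) (fun j => y' j.castSucc) *
          Q.prob (n + 1) (fun j => y' j.castSucc) x' (y' (Fin.last _)) := by
    intro x' y'
    unfold CausalKernel.causalProb
    rw [Fin.prod_univ_castSucc]
    rfl
  simp [h]

lemma causalProb_zero (Q : CausalKernel X Y) (x : Fin 1 → X) (y : Fin 1 → Y) :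
    Q.causalProb 0 x y = Q.prob 0 Fin.elim0 x (y 0) := by
  unfold CausalKernel.causalProb
  rw [Fin.prod_univ_one]
  have h : (fun j : Fin 0 => y (Fin.castLE (Nat.zero_le 1) j)) = Fin.elim0 :=
    Subsingleton.elim _ _
  exact congrArg (fun z => Q.prob 0 z x (y 0)) h

lemma causalProb_nonneg (Q : CausalKernel X Y) (n : ℕ) (x : Fin (n + 1) → X)
    (y : Fin (n + 1) → Y) : 0 ≤ Q.causalProb n x y :=
  Finset.prod_nonneg fun _ _ => Q.nonneg _ _ _ _

/-- The variational lower bound for the information: every nonnegative likelihood ratio `f`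
that integrates to one against the source law, for each `y`, bounds it from below. -/
lemma sum_jointLaw_mul_log_le [Fintype X] (P : (n : ℕ) → (Fin (n + 1) → X) → ℝ) (Q : CausalKernel X Y)
    (n : ℕ) (hP : ∀ x, 0 ≤ P n x) (hsum : ∑ x, ∑ y, jointLaw P Q n x y = 1)
    (g : (Fin (n + 1) → X) → (Fin (n + 1) → Y) → ℝ)
    (hg : ∀ y, ∑ x, P n x * Real.exp (g x y) = 1) :
    ∑ x, ∑ y, jointLaw P Q n x y * g x y ≤ information P Q n * Real.log 2 := by
  have hJ : ∀ x y, 0 ≤ jointLaw P Q n x y := fun x y =>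
    mul_nonneg (hP x) (causalProb_nonneg Q n x y)
  have hR : ∀ x y, jointLaw P Q n x y ≤ reproductionLaw P Q n y := fun x y =>
    Finset.single_le_sum (f := fun x => jointLaw P Q n x y) (fun x _ => hJ x y)
      (Finset.mem_univ x)
  have hR0 : ∀ y, 0 ≤ reproductionLaw P Q n y := fun y => Finset.sum_nonneg fun x _ => hJ x y
  have hlog2 : Real.log 2 ≠ 0 := (Real.log_pos one_lt_two).ne'
  -- This is `t + 1 ≤ exp t` with `t` the difference of `g` and the true log ratio. Both halves of
  -- the correction in parentheses have total mass one, so it cancels after summation.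
  have hpt : ∀ x y, jointLaw P Q n x y * g x y +
      (jointLaw P Q n x y - P n x * Real.exp (g x y) * reproductionLaw P Q n y) ≤
      jointLaw P Q n x y *
        Real.log (Q.causalProb n x y / reproductionLaw P Q n y) := by
    intro x y
    rcases (hJ x y).eq_or_lt with h0 | hpos
    · rw [← h0]
      have := mul_nonneg (mul_nonneg (hP x) (Real.exp_pos (g x y)).le) (hR0 y)
      linarith
    · have hq : 0 < Q.causalProb n x y :=
        (causalProb_nonneg Q n x y).lt_of_ne' fun h => hpos.ne' (by simp [jointLaw, h])
      have hr : 0 < reproductionLaw P Q n y := hpos.trans_le (hR x y)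
      have hlog := Real.add_one_le_exp
        (g x y - Real.log (Q.causalProb n x y / reproductionLaw P Q n y))
      rw [Real.exp_sub, Real.exp_log (div_pos hq hr)] at hlog
      have := mul_le_mul_of_nonneg_left hlog hpos.le
      have he : jointLaw P Q n x y * (Real.exp (g x y) /
          (Q.causalProb n x y / reproductionLaw P Q n y)) =
          P n x * Real.exp (g x y) * reproductionLaw P Q n y := by
        unfold jointLaw
        field_simp
      rw [he] at this
      linarith
  have hinfo : information P Q n * Real.log 2 = ∑ x, ∑ y, jointLaw P Q n x y *
      Real.log (Q.causalProb n x y / reproductionLaw P Q n y) := by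
    simp only [information, Finset.sum_mul, Real.logb]
    refine Finset.sum_congr rfl fun x _ => Finset.sum_congr rfl fun y _ => ?_
    field_simp
  have hmass : ∑ x, ∑ y, P n x * Real.exp (g x y) * reproductionLaw P Q n y = 1 := by
    rw [Finset.sum_comm]
    simp only [← Finset.sum_mul, hg, one_mul]
    rw [← hsum, Finset.sum_comm]
    rfl
  rw [hinfo]
  have := Finset.sum_le_sum fun x (_ : x ∈ Finset.univ) =>
    Finset.sum_le_sum fun y (_ : y ∈ Finset.univ) => hpt x y
  simp only [Finset.sum_add_distrib, Finset.sum_sub_distrib, hsum, hmass] at this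
  linarith

end General

/-! ### The Markov source, expectations, and the backward likelihood ratio. -/

section Source

lemma bsmsTransition_nonneg {p : ℝ} (hp0 : 0 ≤ p) (hp1 : p ≤ 1) (a b : Fin 2) :
    0 ≤ bsmsTransition p a b := by
  unfold bsmsTransition
  split_ifs <;> linarith

lemma bsmsTransition_pos {p : ℝ} (hp0 : 0 < p) (hp1 : p < 1) (a b : Fin 2) :
    0 < bsmsTransition p a b := by
  unfold bsmsTransition
  split_ifs <;> linarith

lemma bsmsTransition_comm (p : ℝ) (a b : Fin 2) : bsmsTransition p a b = bsmsTransition p b a := by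
  simp only [bsmsTransition, eq_comm]

lemma sum_bsmsTransition (p : ℝ) (a : Fin 2) : ∑ b, bsmsTransition p a b = 1 := by
  fin_cases a <;> simp [bsmsTransition]

lemma sum_bsmsTransition_mul (p q : ℝ) (a c : Fin 2) :
    ∑ b, bsmsTransition q a b * bsmsTransition p b c =
      bsmsTransition (p + q - 2 * p * q) a c := by
  fin_cases a <;> fin_cases c <;> simp [bsmsTransition] <;> ring

lemma sum_bsmsTransition_mul_log (p q : ℝ) (a b : Fin 2) :
    ∑ c, bsmsTransition p a c * Real.log (bsmsTransition q b c) =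
      (1 - (p + (1 - 2 * p) * hamming a b)) * Real.log (1 - q) +
        (p + (1 - 2 * p) * hamming a b) * Real.log q := by
  fin_cases a <;> fin_cases b <;> simp [bsmsTransition, hamming] <;> ring

lemma log_bsmsTransition (q : ℝ) (a b : Fin 2) :
    Real.log (bsmsTransition q b a) =
      (1 - hamming a b) * Real.log (1 - q) + hamming a b * Real.log q := by
  fin_cases a <;> fin_cases b <;> simp [bsmsTransition, hamming]

lemma bsmsLaw_snoc (p : ℝ) (n : ℕ) (x : Fin (n + 1) → Fin 2) (a : Fin 2) :
    bsmsLaw p (n + 1) (Fin.snoc x a) = bsmsLaw p n x * bsmsTransition p (x (Fin.last n)) a := by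
  unfold bsmsLaw
  rw [Fin.prod_univ_castSucc, ← mul_assoc]
  simp [Fin.succ_castSucc, -Fin.castSucc_succ]

lemma bsmsLaw_zero (p : ℝ) (x : Fin 1 → Fin 2) : bsmsLaw p 0 x = 1 / 2 := by
  simp [bsmsLaw]

lemma bsmsLaw_nonneg {p : ℝ} (hp0 : 0 ≤ p) (hp1 : p ≤ 1) (n : ℕ) (x : Fin (n + 1) → Fin 2) :
    0 ≤ bsmsLaw p n x :=
  mul_nonneg (by norm_num) (Finset.prod_nonneg fun _ _ => bsmsTransition_nonneg hp0 hp1 _ _)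

lemma sum_fin_one_pi (F : (Fin (0 + 1) → Fin 2) → ℝ) : ∑ x, F x = ∑ a, F fun _ => a := by
  rw [← (Equiv.funUnique (Fin 1) (Fin 2)).symm.sum_comp]
  rfl

lemma sum_bsmsLaw (p : ℝ) (n : ℕ) : ∑ x, bsmsLaw p n x = 1 := by
  induction n with
  | zero => simp [bsmsLaw_zero]
  | succ n ih =>
    simp only [sum_fin_snoc (n + 1), bsmsLaw_snoc, ← Finset.mul_sum, sum_bsmsTransition, mul_one,
      ih]

variable (p : ℝ) (Q : CausalKernel (Fin 2) (Fin 2))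

lemma jointLaw_snoc (n : ℕ) (x : Fin (n + 1) → Fin 2) (a : Fin 2) (y : Fin (n + 1) → Fin 2)
    (b : Fin 2) :
    jointLaw (bsmsLaw p) Q (n + 1) (Fin.snoc x a) (Fin.snoc y b) =
      jointLaw (bsmsLaw p) Q n x y *
        (bsmsTransition p (x (Fin.last n)) a * Q.prob (n + 1) y (Fin.snoc x a) b) := by
  simp only [jointLaw, bsmsLaw_snoc, causalProb_snoc]
  ring

/-- The expectation of `F (X^n, Y^n)` under the joint law. -/
def expect (n : ℕ) (F : (Fin (n + 1) → Fin 2) → (Fin (n + 1) → Fin 2) → ℝ) : ℝ :=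
  ∑ x, ∑ y, jointLaw (bsmsLaw p) Q n x y * F x y

lemma expect_succ (n : ℕ) (F : (Fin (n + 2) → Fin 2) → (Fin (n + 2) → Fin 2) → ℝ) :
    expect p Q (n + 1) F = expect p Q n fun x y => ∑ a, bsmsTransition p (x (Fin.last n)) a *
      ∑ b, Q.prob (n + 1) y (Fin.snoc x a) b * F (Fin.snoc x a) (Fin.snoc y b) := by
  unfold expect
  rw [sum_fin_snoc (n + 1)]
  refine Finset.sum_congr rfl fun x _ => ?_
  simp only [sum_fin_snoc (n + 1), jointLaw_snoc]
  rw [Finset.sum_comm]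
  simp only [Finset.mul_sum, mul_assoc]

lemma expect_add (n : ℕ) (F G : (Fin (n + 1) → Fin 2) → (Fin (n + 1) → Fin 2) → ℝ) :
    expect p Q n (fun x y => F x y + G x y) = expect p Q n F + expect p Q n G := by
  simp only [expect, mul_add, Finset.sum_add_distrib]

lemma expect_sub (n : ℕ) (F G : (Fin (n + 1) → Fin 2) → (Fin (n + 1) → Fin 2) → ℝ) :
    expect p Q n (fun x y => F x y - G x y) = expect p Q n F - expect p Q n G := by
  simp only [expect, mul_sub, Finset.sum_sub_distrib]

lemma expect_mul_const (n : ℕ) (F : (Fin (n + 1) → Fin 2) → (Fin (n + 1) → Fin 2) → ℝ) (c : ℝ) :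
    expect p Q n (fun x y => F x y * c) = expect p Q n F * c := by
  simp only [expect, Finset.sum_mul, mul_assoc]

/-- The newest reproduction letter is integrated out, and without feedback the next source letter
depends on the past only through `x_n`. -/
lemma expect_succ_of_past (n : ℕ)
    (F : (Fin (n + 1) → Fin 2) → (Fin (n + 1) → Fin 2) → Fin 2 → ℝ) :
    expect p Q (n + 1) (fun x y => F (Fin.init x) (Fin.init y) (x (Fin.last (n + 1)))) =
      expect p Q n fun x y => ∑ a, bsmsTransition p (x (Fin.last n)) a * F x y a := by
  rw [expect_succ]
  simp only [Fin.init_snoc, Fin.snoc_last, ← Finset.sum_mul, Q.sum_eq_one, one_mul]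

lemma expect_init (n : ℕ) (F : (Fin (n + 1) → Fin 2) → (Fin (n + 1) → Fin 2) → ℝ) :
    expect p Q (n + 1) (fun x y => F (Fin.init x) (Fin.init y)) = expect p Q n F := by
  rw [expect_succ_of_past p Q n fun x y _ => F x y]
  simp only [← Finset.sum_mul, sum_bsmsTransition, one_mul]

lemma expect_one (n : ℕ) : expect p Q n (fun _ _ => 1) = 1 := by
  induction n with
  | zero =>
    simp only [expect, jointLaw, bsmsLaw_zero, causalProb_zero, sum_fin_one_pi, mul_one]
    simp only [← Finset.mul_sum, Q.sum_eq_one]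
    simp
  | succ n ih => rw [expect_init p Q n fun _ _ => 1, ih]

lemma expect_const (n : ℕ) (c : ℝ) : expect p Q n (fun _ _ => c) = c := by
  simpa [expect_one] using expect_mul_const p Q n (fun _ _ => 1) c

/-- The probability that the source and the reproduction differ at time `n`. -/
def mismatch (n : ℕ) : ℝ :=
  expect p Q n fun x y => hamming (x (Fin.last n)) (y (Fin.last n))

lemma expect_sum_hamming (n : ℕ) :
    expect p Q n (fun x y => ∑ i, hamming (x i) (y i)) =
      ∑ i ∈ Finset.range (n + 1), mismatch p Q i := by
  induction n with
  | zero => simp [mismatch]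
  | succ n ih =>
    rw [Finset.sum_range_succ, ← ih,
      ← expect_init p Q n fun x y => ∑ i, hamming (x i) (y i), mismatch, ← expect_add]
    simp only [Fin.sum_univ_castSucc (n := n + 1)]
    rfl

lemma avgDistortion_eq (n : ℕ) :
    avgDistortion (bsmsLaw p) hamming Q n =
      (∑ i ∈ Finset.range (n + 1), mismatch p Q i) / ((n : ℝ) + 1) := by
  rw [← expect_sum_hamming]
  rfl

/-- The logarithm of the likelihood ratio of the backward test channel: `Y_i` is turned into
`X_i` by a symmetric channel with crossover probability `δ`. -/
def logRatio (δ : ℝ) : (n : ℕ) → (Fin (n + 1) → Fin 2) → (Fin (n + 1) → Fin 2) → ℝ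
  | 0, x, y => Real.log 2 + Real.log (bsmsTransition δ (y 0) (x 0))
  | n + 1, x, y => logRatio δ n (Fin.init x) (Fin.init y) +
      Real.log (bsmsTransition δ (y (Fin.last (n + 1))) (x (Fin.last (n + 1)))) -
      Real.log (bsmsTransition (p + δ - 2 * p * δ) (Fin.init y (Fin.last n))
        (x (Fin.last (n + 1))))

lemma logRatio_snoc (δ : ℝ) (n : ℕ) (x : Fin (n + 1) → Fin 2) (a : Fin 2)
    (y : Fin (n + 1) → Fin 2) (b : Fin 2) :
    logRatio p δ (n + 1) (Fin.snoc x a) (Fin.snoc y b) = logRatio p δ n x y +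
      Real.log (bsmsTransition δ b a) -
      Real.log (bsmsTransition (p + δ - 2 * p * δ) (y (Fin.last n)) a) := by
  simp only [logRatio, Fin.init_snoc, Fin.snoc_last]

/-- Under the tilted law, `x_n` is distributed as the channel output from `y_n`. The test function
`G` keeps this information through the induction; `G = 1` gives the normalization needed by the
variational bound. -/
lemma sum_bsmsLaw_mul_exp_logRatio {δ : ℝ} (hδ0 : 0 < δ) (hδ1 : δ < 1)
    (hr0 : 0 < p + δ - 2 * p * δ) (hr1 : p + δ - 2 * p * δ < 1) (n : ℕ)
    (y : Fin (n + 1) → Fin 2) (G : Fin 2 → ℝ) :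
    ∑ x, bsmsLaw p n x * Real.exp (logRatio p δ n x y) * G (x (Fin.last n)) =
      ∑ a, bsmsTransition δ (y (Fin.last n)) a * G a := by
  induction n generalizing G with
  | zero =>
    rw [sum_fin_one_pi]
    refine Finset.sum_congr rfl fun a _ => ?_
    rw [bsmsLaw_zero, logRatio, Real.exp_add, Real.exp_log two_pos,
      Real.exp_log (bsmsTransition_pos hδ0 hδ1 _ _)]
    simp
  | succ n ih =>
    induction y using Fin.snocCases with
    | snoc y b =>
    -- The test function averages over the next letter; composing the backward channel with the
    -- source step then produces exactly the denominator `r`-channel, which cancels.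
    have h := ih y fun c => ∑ a, bsmsTransition p c a * (bsmsTransition δ b a * G a /
      bsmsTransition (p + δ - 2 * p * δ) (y (Fin.last n)) a)
    rw [sum_fin_snoc (n + 1)]
    simp only [Fin.snoc_last, logRatio_snoc, bsmsLaw_snoc]
    calc _ = ∑ x, bsmsLaw p n x * Real.exp (logRatio p δ n x y) *
          ∑ a, bsmsTransition p (x (Fin.last n)) a * (bsmsTransition δ b a * G a /
            bsmsTransition (p + δ - 2 * p * δ) (y (Fin.last n)) a) := by
          refine Finset.sum_congr rfl fun x _ => ?_
          rw [Finset.mul_sum]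
          refine Finset.sum_congr rfl fun a _ => ?_
          rw [Real.exp_sub, Real.exp_add, Real.exp_log (bsmsTransition_pos hδ0 hδ1 _ _),
            Real.exp_log (bsmsTransition_pos hr0 hr1 _ _)]
          ring
      _ = _ := by
          rw [h]
          simp only [Finset.mul_sum]
          rw [Finset.sum_comm]
          refine Finset.sum_congr rfl fun a _ => ?_
          simp only [← mul_assoc]
          rw [← Finset.sum_mul, sum_bsmsTransition_mul]
          have := (bsmsTransition_pos hr0 hr1 (y (Fin.last n)) a).ne'
          rw [mul_div_assoc', mul_div_cancel_left₀ _ this]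

/-- The expected value of `log T` for the symmetric channel with crossover probability `q`
when the crossover in fact has probability `d`. -/
def crossLog (q d : ℝ) : ℝ :=
  (1 - d) * Real.log (1 - q) + d * Real.log q

lemma crossLog_self (q : ℝ) : crossLog q q = -Real.binEntropy q := by
  simp only [crossLog, Real.binEntropy, Real.log_inv]
  ring

lemma expect_log_bsmsTransition (q : ℝ) (n : ℕ) :
    expect p Q n (fun x y => Real.log (bsmsTransition q (y (Fin.last n)) (x (Fin.last n)))) =
      crossLog q (mismatch p Q n) := by
  have h : ∀ a b : Fin 2, Real.log (bsmsTransition q b a) =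
      Real.log (1 - q) + hamming a b * (Real.log q - Real.log (1 - q)) := fun a b => by
    rw [log_bsmsTransition]
    ring
  simp only [h, expect_add, expect_mul_const, expect_const, crossLog, mismatch]
  ring

/-- Comparing `x_{n+1}` with `y_n` composes the mismatch at time `n` with an independent source
flip. -/
lemma expect_log_bsmsTransition_succ (q : ℝ) (n : ℕ) :
    expect p Q (n + 1) (fun x y =>
      Real.log (bsmsTransition q (Fin.init y (Fin.last n)) (x (Fin.last (n + 1))))) =
      crossLog q (p + (1 - 2 * p) * mismatch p Q n) := by
  rw [expect_succ_of_past p Q n fun _ y a => Real.log (bsmsTransition q (y (Fin.last n)) a)]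
  have h : ∀ a b : Fin 2, ∑ c, bsmsTransition p a c * Real.log (bsmsTransition q b c) =
      crossLog q p + hamming a b * ((1 - 2 * p) * (Real.log q - Real.log (1 - q))) :=
    fun a b => by
      rw [sum_bsmsTransition_mul_log, crossLog]
      ring
  simp only [h, expect_add, expect_mul_const, expect_const, crossLog, mismatch]
  ring

/-- The second sum is one term shorter because the time-zero denominator is the uniform law, which
contributes `log 2`. -/
lemma expect_logRatio (δ : ℝ) (n : ℕ) :
    expect p Q n (logRatio p δ n) = Real.log 2 +
      ∑ i ∈ Finset.range (n + 1), crossLog δ (mismatch p Q i) -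
      ∑ i ∈ Finset.range n,
        crossLog (p + δ - 2 * p * δ) (p + (1 - 2 * p) * mismatch p Q i) := by
  induction n with
  | zero =>
    have := expect_log_bsmsTransition p Q δ 0
    simp only [Fin.last_zero] at this
    simp [logRatio, expect_add, expect_const, this]
  | succ n ih =>
    rw [Finset.sum_range_succ, Finset.sum_range_succ (fun i => crossLog (p + δ - 2 * p * δ) _)]
    simp only [logRatio]
    rw [expect_sub, expect_add, expect_init, ih, expect_log_bsmsTransition p Q δ (n + 1),
      expect_log_bsmsTransition_succ]
    ring

end Source

/-! ### The converse. -/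

section LowerBound

variable {p : ℝ} (Q : CausalKernel (Fin 2) (Fin 2))

lemma expect_mono (hp0 : 0 ≤ p) (hp1 : p ≤ 1) (n : ℕ)
    {F G : (Fin (n + 1) → Fin 2) → (Fin (n + 1) → Fin 2) → ℝ} (h : ∀ x y, F x y ≤ G x y) :
    expect p Q n F ≤ expect p Q n G :=
  Finset.sum_le_sum fun x _ => Finset.sum_le_sum fun y _ => mul_le_mul_of_nonneg_left (h x y)
    (mul_nonneg (bsmsLaw_nonneg hp0 hp1 n x) (causalProb_nonneg Q n x y))

lemma mismatch_mem_Icc (hp0 : 0 ≤ p) (hp1 : p ≤ 1) (n : ℕ) :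
    mismatch p Q n ∈ Set.Icc (0 : ℝ) 1 := by
  have h : ∀ a b : Fin 2, hamming a b ∈ Set.Icc (0 : ℝ) 1 := fun a b => by
    unfold hamming
    split_ifs <;> simp
  constructor
  · rw [← expect_const p Q n 0]
    exact expect_mono Q hp0 hp1 n fun x y => (h _ _).1
  · rw [← expect_const p Q n 1]
    exact expect_mono Q hp0 hp1 n fun x y => (h _ _).2

lemma expect_logRatio_le_information (hp0 : 0 ≤ p) (hp1 : p ≤ 1) {δ : ℝ} (hδ0 : 0 < δ)
    (hδ1 : δ < 1) (hr0 : 0 < p + δ - 2 * p * δ) (hr1 : p + δ - 2 * p * δ < 1) (n : ℕ) :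
    expect p Q n (logRatio p δ n) ≤ information (bsmsLaw p) Q n * Real.log 2 := by
  refine sum_jointLaw_mul_log_le _ Q n (bsmsLaw_nonneg hp0 hp1 n) ?_ _ fun y => ?_
  · simpa [expect] using expect_one p Q n
  · simpa only [mul_one, sum_bsmsTransition] using
      sum_bsmsLaw_mul_exp_logRatio p hδ0 hδ1 hr0 hr1 n y fun _ => 1

/-- The derivative at `δ` of the Lagrangian dual of the rate. -/
def slope (p δ : ℝ) : ℝ :=
  Real.log δ - Real.log (1 - δ) -
    (1 - 2 * p) * (Real.log (p + δ - 2 * p * δ) - Real.log (1 - (p + δ - 2 * p * δ)))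

/-- With zero slope the bound at `δ = 1/2` needs no distortion constraint, which settles `D ≥ 1/2`.
-/
lemma slope_half (p : ℝ) : slope p (1 / 2) = 0 := by
  have h : p + 1 / 2 - 2 * p * (1 / 2) = 1 / 2 := by ring
  rw [slope, h]
  norm_num

lemma crossover_mem_Icc (hp0 : 0 ≤ p) (hp1 : p ≤ 1) {δ : ℝ} (hδ1 : δ ≤ 1 / 2) :
    p + δ - 2 * p * δ ∈ Set.Icc δ (1 - δ) := by
  constructor <;> nlinarith

/-- As `r` lies in `[δ, 1 - δ]`, its log-odds are at most those of `1 - δ` in absolute value, and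
`|1 - 2p| ≤ 1`. -/
lemma slope_nonpos (hp0 : 0 ≤ p) (hp1 : p ≤ 1) {δ : ℝ} (hδ0 : 0 < δ) (hδ1 : δ ≤ 1 / 2) :
    slope p δ ≤ 0 := by
  obtain ⟨h1, h2⟩ := crossover_mem_Icc hp0 hp1 hδ1
  set r := p + δ - 2 * p * δ
  have ha : Real.log δ ≤ Real.log r := Real.log_le_log hδ0 h1
  have hb : Real.log r ≤ Real.log (1 - δ) := Real.log_le_log (by linarith) h2
  have hc : Real.log δ ≤ Real.log (1 - r) := Real.log_le_log hδ0 (by linarith)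
  have hd : Real.log (1 - r) ≤ Real.log (1 - δ) := Real.log_le_log (by linarith) (by linarith)
  unfold slope
  nlinarith

/-- Both terms are affine in `e`, and at `e = δ` they are negative entropies. -/
lemma crossLog_sub_crossLog (p δ e : ℝ) :
    crossLog δ e - crossLog (p + δ - 2 * p * δ) (p + (1 - 2 * p) * e) =
      Real.binEntropy (p + δ - 2 * p * δ) - Real.binEntropy δ + slope p δ * (e - δ) := by
  simp only [crossLog, slope, Real.binEntropy, Real.log_inv]
  ring

lemma information_lower_bound (hp0 : 0 ≤ p) (hp1 : p ≤ 1) {δ : ℝ} (hδ0 : 0 < δ)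
    (hδ1 : δ ≤ 1 / 2) (n : ℕ) (hQ : avgDistortion (bsmsLaw p) hamming Q n ≤ δ ∨ δ = 1 / 2) :
    ((n : ℝ) + 1) * (Real.binEntropy (p + δ - 2 * p * δ) - Real.binEntropy δ) +
        (Real.log (p + δ - 2 * p * δ) + Real.log (1 - (p + δ - 2 * p * δ))) ≤
      information (bsmsLaw p) Q n * Real.log 2 := by
  obtain ⟨h1, h2⟩ := crossover_mem_Icc hp0 hp1 hδ1
  have hr0 : 0 < p + δ - 2 * p * δ := by linarith
  have hr1 : p + δ - 2 * p * δ < 1 := by linarith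
  refine le_trans ?_ (expect_logRatio_le_information Q hp0 hp1 hδ0 (by linarith) hr0 hr1 n)
  have hn : (0 : ℝ) < (n : ℝ) + 1 := by positivity
  have hsum : ∑ i ∈ Finset.range (n + 1), (crossLog δ (mismatch p Q i) -
      crossLog (p + δ - 2 * p * δ) (p + (1 - 2 * p) * mismatch p Q i)) =
      ((n : ℝ) + 1) * (Real.binEntropy (p + δ - 2 * p * δ) - Real.binEntropy δ) +
        slope p δ * (((n : ℝ) + 1) * (avgDistortion (bsmsLaw p) hamming Q n - δ)) := by
    simp only [crossLog_sub_crossLog, Finset.sum_add_distrib, ← Finset.mul_sum,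
      Finset.sum_sub_distrib, Finset.sum_const, Finset.card_range, nsmul_eq_mul,
      avgDistortion_eq]
    push_cast
    field_simp
  have hs : 0 ≤ slope p δ * (((n : ℝ) + 1) * (avgDistortion (bsmsLaw p) hamming Q n - δ)) := by
    rcases hQ with hQ | rfl
    · exact mul_nonneg_of_nonpos_of_nonpos (slope_nonpos hp0 hp1 hδ0 hδ1)
        (mul_nonpos_of_nonneg_of_nonpos hn.le (by linarith))
    · rw [slope_half, zero_mul]
  rw [Finset.sum_sub_distrib, Finset.sum_range_succ (fun i => crossLog (p + δ - 2 * p * δ) _)]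
    at hsum
  rw [expect_logRatio]
  -- The term at time `n` has no partner. It is bounded independently of `Q`: both logarithms are
  -- nonpositive and their weights are at most one.
  have hlast : Real.log (p + δ - 2 * p * δ) + Real.log (1 - (p + δ - 2 * p * δ)) ≤
      crossLog (p + δ - 2 * p * δ) (p + (1 - 2 * p) * mismatch p Q n) := by
    obtain ⟨e0, e1⟩ := mismatch_mem_Icc Q hp0 hp1 n
    have l0 := Real.log_nonpos hr0.le hr1.le
    have l1 := Real.log_nonpos (x := 1 - (p + δ - 2 * p * δ)) (by linarith) (by linarith)
    have d0 : 0 ≤ p + (1 - 2 * p) * mismatch p Q n := by nlinarith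
    have d1 : p + (1 - 2 * p) * mismatch p Q n ≤ 1 := by nlinarith
    unfold crossLog
    nlinarith
  have := Real.log_pos one_lt_two
  linarith

lemma H_mParam (p D : ℝ) : H (mParam p D) = Real.binEntropy (p + D - 2 * p * D) / Real.log 2 := by
  rw [H, ← Real.binEntropy_one_sub]
  congr 2
  unfold mParam
  ring

lemma continuous_rate (p : ℝ) : Continuous fun D => H (mParam p D) - H D := by
  simp only [H, mParam]
  have := Real.binEntropy_continuous
  fun_prop

lemma rate_half (p : ℝ) : H (mParam p (1 / 2)) - H (1 / 2) = 0 := by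
  have : mParam p (1 / 2) = 1 / 2 := by
    unfold mParam
    ring
  rw [this, sub_self]

/-- The error constant does not involve `Q`, so one threshold for `n` serves all kernels; this lets
the bound pass to the infimum. -/
lemma eventually_lt_information (hp0 : 0 ≤ p) (hp1 : p ≤ 1) {δ r : ℝ} (hδ0 : 0 < δ)
    (hδ1 : δ ≤ 1 / 2) (hr : r < H (mParam p δ) - H δ) :
    ∀ᶠ n : ℕ in Filter.atTop, ∀ Q : CausalKernel (Fin 2) (Fin 2),
      avgDistortion (bsmsLaw p) hamming Q n ≤ δ ∨ δ = 1 / 2 →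
        r < information (bsmsLaw p) Q n / ((n : ℝ) + 1) := by
  have hlog2 := Real.log_pos one_lt_two
  rw [H_mParam, H, ← sub_div, lt_div_iff₀ hlog2] at hr
  set φ := Real.binEntropy (p + δ - 2 * p * δ) - Real.binEntropy δ
  set C := Real.log (p + δ - 2 * p * δ) + Real.log (1 - (p + δ - 2 * p * δ)) with hC
  have hlim : Filter.Tendsto (fun n : ℕ => φ + C * (1 / ((n : ℝ) + 1))) Filter.atTop
      (nhds (φ + C * 0)) :=
    (tendsto_one_div_add_atTop_nhds_zero_nat.const_mul C).const_add φ
  rw [mul_zero, add_zero] at hlim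
  filter_upwards [hlim.eventually (lt_mem_nhds hr)] with n hn Q hQ
  have h := information_lower_bound Q hp0 hp1 hδ0 hδ1 n hQ
  have hn0 : (0 : ℝ) < (n : ℝ) + 1 := by positivity
  rw [lt_div_iff₀ hn0]
  refine lt_of_mul_lt_mul_right ?_ hlog2.le
  calc r * ((n : ℝ) + 1) * Real.log 2 = r * Real.log 2 * ((n : ℝ) + 1) := by ring
    _ < (φ + C * (1 / ((n : ℝ) + 1))) * ((n : ℝ) + 1) := mul_lt_mul_of_pos_right hn hn0
    _ = ((n : ℝ) + 1) * φ + C := by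
      field_simp
    _ ≤ _ := h

/-- The converse: the information rate at distortion slightly above `D` is asymptotically at
least the rate at `min D (1 / 2)`, uniformly in the reproduction distribution. -/
lemma exists_eventually_lt_information (hp0 : 0 ≤ p) (hp1 : p ≤ 1) {D r : ℝ} (hD : 0 ≤ D)
    (hr : r < if D ≤ 1 / 2 then H (mParam p D) - H D else 0) :
    ∃ δ > D, ∀ᶠ n : ℕ in Filter.atTop, ∀ Q : CausalKernel (Fin 2) (Fin 2),
      avgDistortion (bsmsLaw p) hamming Q n ≤ δ →
        r < information (bsmsLaw p) Q n / ((n : ℝ) + 1) := by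
  rcases lt_or_ge D (1 / 2) with h | h
  · rw [if_pos h.le] at hr
    have h1 : ∀ᶠ δ in nhdsWithin D (Set.Ioi D), r < H (mParam p δ) - H δ :=
      nhdsWithin_le_nhds ((continuous_rate p).continuousAt.eventually (lt_mem_nhds hr))
    have h2 : ∀ᶠ δ in nhdsWithin D (Set.Ioi D), δ ∈ Set.Ioo D (1 / 2) := Ioo_mem_nhdsGT h
    obtain ⟨δ, hδ, hDδ, hδ2⟩ := (h1.and h2).exists
    refine ⟨δ, hDδ, ?_⟩
    filter_upwards [eventually_lt_information hp0 hp1 (hD.trans_lt hDδ) hδ2.le hδ] with n hn Q hQ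
    exact hn Q (Or.inl hQ)
  · have hr0 : r < H (mParam p (1 / 2)) - H (1 / 2) := by
      rcases h.eq_or_lt with rfl | h
      · simpa using hr
      · rwa [if_neg h.not_ge, ← rate_half p] at hr
    -- Any value above `D` would do, since the distortion bound is not used here.
    refine ⟨D + 1, by linarith, ?_⟩
    filter_upwards [eventually_lt_information hp0 hp1 one_half_pos le_rfl hr0] with n hn Q _
    exact hn Q (Or.inr rfl)

end LowerBound

/-! ### The kernel `Q*` and its joint law. -/

section Optimal

variable {p D : ℝ} (hp0 : 0 ≤ p) (hp1 : p ≤ 1) (hD0 : 0 ≤ D) (hD1 : D ≤ 1 / 2)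

/-- The denominator is `(1-p)(1-D) + pD`, a sum of nonnegative terms, so if it vanishes the
numerator does too and the convention for division by zero is harmless. The same argument serves
`beta_mul`. -/
lemma alpha_mul (hp0 : 0 ≤ p) (hp1 : p ≤ 1) (hD0 : 0 ≤ D) (hD1 : D ≤ 1 / 2) :
    alpha p D * (1 - p - D + 2 * p * D) = (1 - p) * (1 - D) := by
  have h1 : 0 ≤ (1 - p) * (1 - D) := mul_nonneg (by linarith) (by linarith)
  have h2 : 0 ≤ p * D := mul_nonneg hp0 hD0
  rcases eq_or_ne (1 - p - D + 2 * p * D) 0 with h | h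
  · rw [h, mul_zero]
    linarith
  · exact div_mul_cancel₀ _ h

lemma beta_mul (hp0 : 0 ≤ p) (hp1 : p ≤ 1) (hD0 : 0 ≤ D) (hD1 : D ≤ 1 / 2) :
    beta p D * (p + D - 2 * p * D) = p * (1 - D) := by
  have h1 : 0 ≤ p * (1 - D) := mul_nonneg hp0 (by linarith)
  have h2 : 0 ≤ (1 - p) * D := mul_nonneg (by linarith) hD0
  rcases eq_or_ne (p + D - 2 * p * D) 0 with h | h
  · rw [h, mul_zero]
    linarith
  · exact div_mul_cancel₀ _ h

lemma alpha_mem_Icc (hp0 : 0 ≤ p) (hp1 : p ≤ 1) (hD0 : 0 ≤ D) (hD1 : D ≤ 1 / 2) :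
    alpha p D ∈ Set.Icc (0 : ℝ) 1 := by
  have h1 : 0 ≤ (1 - p) * (1 - D) := mul_nonneg (by linarith) (by linarith)
  have h2 : 0 ≤ p * D := mul_nonneg hp0 hD0
  exact ⟨div_nonneg h1 (by linarith), div_le_one_of_le₀ (by linarith) (by linarith)⟩

lemma beta_mem_Icc (hp0 : 0 ≤ p) (hp1 : p ≤ 1) (hD0 : 0 ≤ D) (hD1 : D ≤ 1 / 2) :
    beta p D ∈ Set.Icc (0 : ℝ) 1 := by
  have h1 : 0 ≤ p * (1 - D) := mul_nonneg hp0 (by linarith)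
  have h2 : 0 ≤ (1 - p) * D := mul_nonneg (by linarith) hD0
  exact ⟨div_nonneg h1 (by linarith), div_le_one_of_le₀ (by linarith) (by linarith)⟩

/-- Bayes' rule: `Q*` is the forward channel of the backward symmetric test channel. -/
lemma bsmsTransition_mul_optimalKernel (hp0 : 0 ≤ p) (hp1 : p ≤ 1) (hD0 : 0 ≤ D)
    (hD1 : D ≤ 1 / 2) (y x b : Fin 2) :
    bsmsTransition (p + D - 2 * p * D) y x * optimalKernel p D y x b =
      bsmsTransition p y b * bsmsTransition D b x := by
  have ha := alpha_mul hp0 hp1 hD0 hD1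
  have hb := beta_mul hp0 hp1 hD0 hD1
  fin_cases y <;> fin_cases x <;> fin_cases b <;> simp [bsmsTransition, optimalKernel] <;>
    linarith

lemma optimalKernel_nonneg (hp0 : 0 ≤ p) (hp1 : p ≤ 1) (hD0 : 0 ≤ D) (hD1 : D ≤ 1 / 2)
    (y x b : Fin 2) : 0 ≤ optimalKernel p D y x b := by
  obtain ⟨ha0, ha1⟩ := alpha_mem_Icc hp0 hp1 hD0 hD1
  obtain ⟨hb0, hb1⟩ := beta_mem_Icc hp0 hp1 hD0 hD1
  fin_cases y <;> fin_cases x <;> fin_cases b <;> simp [optimalKernel] <;> linarith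

lemma sum_optimalKernel (p D : ℝ) (y x : Fin 2) : ∑ b, optimalKernel p D y x b = 1 := by
  fin_cases y <;> fin_cases x <;> simp [optimalKernel]

/-- The causal reproduction distribution `Q*`. -/
def optimalCausalKernel : CausalKernel (Fin 2) (Fin 2) where
  prob
    | 0, _, x, b => if b = x 0 then 1 - D else D
    | i + 1, y, x, b => optimalKernel p D (y (Fin.last i)) (x (Fin.last (i + 1))) b
  nonneg
    | 0, _, x, b => bsmsTransition_nonneg hD0 (by linarith) b (x 0)
    | i + 1, y, x, b => optimalKernel_nonneg hp0 hp1 hD0 hD1 _ _ b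
  sum_eq_one
    | 0, _, x => by
      have h := sum_bsmsTransition D (x 0)
      simp only [bsmsTransition_comm D (x 0)] at h
      exact h
    | i + 1, y, x => sum_optimalKernel p D _ _

local notation "Qopt" => optimalCausalKernel hp0 hp1 hD0 hD1

lemma jointLaw_optimal_zero (x y : Fin 1 → Fin 2) :
    jointLaw (bsmsLaw p) Qopt 0 x y = 1 / 2 * bsmsTransition D (y 0) (x 0) := by
  rw [jointLaw, bsmsLaw_zero, causalProb_zero]
  rfl

lemma jointLaw_optimal_snoc (n : ℕ) (x : Fin (n + 1) → Fin 2) (a : Fin 2)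
    (y : Fin (n + 1) → Fin 2) (b : Fin 2) :
    jointLaw (bsmsLaw p) Qopt (n + 1) (Fin.snoc x a) (Fin.snoc y b) =
      jointLaw (bsmsLaw p) Qopt n x y * (bsmsTransition p (x (Fin.last n)) a *
        optimalKernel p D (y (Fin.last n)) a b) := by
  rw [jointLaw_snoc]
  simp [optimalCausalKernel]

/-- Bayes' rule propagates the backward description: `Y^n` has the source law, and given `Y^n` the
letter `X_n` is `Y_n` through the `D`-channel. -/
lemma sum_jointLaw_optimal_mul (n : ℕ) (y : Fin (n + 1) → Fin 2) (G : Fin 2 → ℝ) :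
    ∑ x, jointLaw (bsmsLaw p) Qopt n x y * G (x (Fin.last n)) =
      bsmsLaw p n y * ∑ a, bsmsTransition D (y (Fin.last n)) a * G a := by
  induction n generalizing G with
  | zero =>
    rw [sum_fin_one_pi, bsmsLaw_zero, Finset.mul_sum]
    refine Finset.sum_congr rfl fun a _ => ?_
    rw [jointLaw_optimal_zero, mul_assoc]
    rfl
  | succ n ih =>
    induction y using Fin.snocCases with
    | snoc y b =>
    have h := ih y fun c => ∑ a, bsmsTransition p c a *
      (optimalKernel p D (y (Fin.last n)) a b * G a)
    rw [sum_fin_snoc (n + 1)]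
    simp only [Fin.snoc_last, bsmsLaw_snoc, jointLaw_optimal_snoc]
    simp only [Finset.mul_sum] at h ⊢
    simp only [mul_assoc] at h ⊢
    rw [h, Finset.sum_comm]
    refine Finset.sum_congr rfl fun a _ => ?_
    rw [← Finset.mul_sum]
    congr 1
    simp only [← mul_assoc]
    rw [← Finset.sum_mul, ← Finset.sum_mul, sum_bsmsTransition_mul,
      bsmsTransition_mul_optimalKernel hp0 hp1 hD0 hD1]

lemma reproductionLaw_optimal (n : ℕ) (y : Fin (n + 1) → Fin 2) :
    reproductionLaw (bsmsLaw p) Qopt n y = bsmsLaw p n y := by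
  simpa only [mul_one, sum_bsmsTransition, reproductionLaw] using
    sum_jointLaw_optimal_mul hp0 hp1 hD0 hD1 n y fun _ => 1

lemma mismatch_optimal (n : ℕ) : mismatch p Qopt n = D := by
  have h : ∀ b : Fin 2, ∑ a, bsmsTransition D b a * hamming a b = D := fun b => by
    fin_cases b <;> simp [bsmsTransition, hamming]
  rw [mismatch, expect, Finset.sum_comm]
  simp only [fun y : Fin (n + 1) → Fin 2 => sum_jointLaw_optimal_mul hp0 hp1 hD0 hD1 n y
    fun a => hamming a (y (Fin.last n)), h]
  rw [← Finset.sum_mul, sum_bsmsLaw, one_mul]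

lemma avgDistortion_optimal (n : ℕ) : avgDistortion (bsmsLaw p) hamming Qopt n = D := by
  rw [avgDistortion_eq]
  simp only [mismatch_optimal, Finset.sum_const, Finset.card_range, nsmul_eq_mul]
  push_cast
  field_simp

lemma jointlyStationary_optimal : JointlyStationary (bsmsLaw p) Qopt := by
  intro n
  induction n with
  | zero =>
    intro x y
    have hc : ∀ (z : Fin 1 → Fin 2) (a : Fin 2),
        (Fin.cons a z : Fin 2 → Fin 2) = Fin.snoc (fun _ : Fin 1 => a) (z 0) := by
      intro z a
      funext i
      fin_cases i <;> rfl
    rw [jointLaw_optimal_zero, Finset.sum_comm]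
    simp only [hc, jointLaw_optimal_snoc, jointLaw_optimal_zero]
    -- Summing out `x_0` first creates the `r`-channel, so that Bayes' rule applies; then `y_0` sums
    -- out by symmetry of the source transition.
    calc _ = ∑ b, 1 / 2 * ((∑ a, bsmsTransition D b a * bsmsTransition p a (x 0)) *
          optimalKernel p D b (x 0) (y 0)) := by
          simp only [Finset.sum_mul, Finset.mul_sum, mul_assoc]
      _ = _ := by
          simp only [sum_bsmsTransition_mul,
            bsmsTransition_mul_optimalKernel hp0 hp1 hD0 hD1]
          rw [← Finset.mul_sum, ← Finset.sum_mul]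
          simp only [fun b => bsmsTransition_comm p b (y 0), sum_bsmsTransition, one_mul]
  | succ n ih =>
    intro x y
    induction x using Fin.snocCases with
    | snoc x a =>
    induction y using Fin.snocCases with
    | snoc y b =>
    -- The step factor sees only the last pair and the new one, so prepending a letter leaves it
    -- unchanged.
    simp only [Fin.cons_snoc_eq_snoc_cons, jointLaw_optimal_snoc, ← ih, Finset.sum_mul]
    rfl

/-- When `D = 0` or `p ∈ {0, 1}` some factors vanish and logarithms do not split, so equality is
claimed only on the support. The first conjunct feeds the induction. -/
lemma jointLaw_optimal_support (n : ℕ) (x y : Fin (n + 1) → Fin 2)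
    (h : jointLaw (bsmsLaw p) Qopt n x y ≠ 0) :
    bsmsTransition D (y (Fin.last n)) (x (Fin.last n)) ≠ 0 ∧
      Real.log (CausalKernel.causalProb Qopt n x y / bsmsLaw p n y) = logRatio p D n x y := by
  induction n with
  | zero =>
    rw [jointLaw_optimal_zero] at h
    have hV : bsmsTransition D (y 0) (x 0) ≠ 0 := right_ne_zero_of_mul h
    refine ⟨hV, ?_⟩
    have hq : CausalKernel.causalProb Qopt 0 x y = bsmsTransition D (y 0) (x 0) := by
      rw [causalProb_zero]
      rfl
    rw [hq, bsmsLaw_zero, logRatio, ← Real.log_mul two_ne_zero hV]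
    congr 1
    ring
  | succ n ih =>
    induction x using Fin.snocCases with
    | snoc x a =>
    induction y using Fin.snocCases with
    | snoc y b =>
    rw [jointLaw_optimal_snoc] at h
    have hJ := left_ne_zero_of_mul h
    have hT := left_ne_zero_of_mul (right_ne_zero_of_mul h)
    have hK := right_ne_zero_of_mul (right_ne_zero_of_mul h)
    obtain ⟨hV, hlog⟩ := ih x y hJ
    have hD2 : D ≤ 1 := by linarith
    -- The path from `y_n` through the actual `x_n` to `a` already has positive weight.
    have hV' : bsmsTransition (p + D - 2 * p * D) (y (Fin.last n)) a ≠ 0 := by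
      rw [← sum_bsmsTransition_mul]
      refine (lt_of_lt_of_le ?_ (Finset.single_le_sum (fun c _ => mul_nonneg
        (bsmsTransition_nonneg hD0 hD2 _ c) (bsmsTransition_nonneg hp0 hp1 c a))
        (Finset.mem_univ (x (Fin.last n))))).ne'
      exact (mul_nonneg (bsmsTransition_nonneg hD0 hD2 _ _)
        (bsmsTransition_nonneg hp0 hp1 _ _)).lt_of_ne' (mul_ne_zero hV hT)
    have hB := bsmsTransition_mul_optimalKernel hp0 hp1 hD0 hD1 (y (Fin.last n)) a b
    have hTV : bsmsTransition p (y (Fin.last n)) b * bsmsTransition D b a ≠ 0 :=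
      hB ▸ mul_ne_zero hV' hK
    have hQ : CausalKernel.causalProb Qopt n x y ≠ 0 := right_ne_zero_of_mul hJ
    have hL : bsmsLaw p n y ≠ 0 := by
      rw [← reproductionLaw_optimal hp0 hp1 hD0 hD1]
      refine (lt_of_lt_of_le ?_ (Finset.single_le_sum (f := fun x =>
        jointLaw (bsmsLaw p) Qopt n x y) (fun x _ => mul_nonneg (bsmsLaw_nonneg hp0 hp1 n x)
        (causalProb_nonneg _ n x y)) (Finset.mem_univ x))).ne'
      exact (mul_nonneg (bsmsLaw_nonneg hp0 hp1 n x) (causalProb_nonneg _ n x y)).lt_of_ne' hJ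
    have hTb := left_ne_zero_of_mul hTV
    have hVb := right_ne_zero_of_mul hTV
    simp only [Fin.snoc_last]
    refine ⟨hVb, ?_⟩
    have hK' : (Qopt).prob (n + 1) y (Fin.snoc x a) b = optimalKernel p D (y (Fin.last n)) a b := by
      simp [optimalCausalKernel]
    rw [causalProb_snoc, hK', bsmsLaw_snoc, logRatio_snoc, ← hlog, Real.log_div
      (mul_ne_zero hQ hK) (mul_ne_zero hL hTb), Real.log_mul hQ hK, Real.log_mul hL hTb,
      Real.log_div hQ hL]
    have := congrArg Real.log hB
    rw [Real.log_mul hV' hK, Real.log_mul hTb hVb] at this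
    linarith

lemma information_optimal (n : ℕ) :
    information (bsmsLaw p) Qopt n = 1 - H D + n * (H (mParam p D) - H D) := by
  have hlog2 : Real.log 2 ≠ 0 := (Real.log_pos one_lt_two).ne'
  have h1 : information (bsmsLaw p) Qopt n = expect p Qopt n (logRatio p D n) / Real.log 2 := by
    simp only [information, expect, Finset.sum_div, Real.logb, reproductionLaw_optimal]
    refine Finset.sum_congr rfl fun x _ => Finset.sum_congr rfl fun y _ => ?_
    by_cases h : jointLaw (bsmsLaw p) Qopt n x y = 0
    · simp [h]
    · rw [(jointLaw_optimal_support hp0 hp1 hD0 hD1 n x y h).2, mul_div_assoc]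
  have h2 : p + (1 - 2 * p) * D = p + D - 2 * p * D := by ring
  rw [h1, expect_logRatio]
  simp only [mismatch_optimal, h2, crossLog_self, Finset.sum_const, Finset.card_range,
    nsmul_eq_mul, H_mParam]
  rw [H]
  push_cast
  field_simp
  ring

lemma tendsto_information_optimal :
    Filter.Tendsto (fun n : ℕ => information (bsmsLaw p) Qopt n / ((n : ℝ) + 1)) Filter.atTop
      (nhds (H (mParam p D) - H D)) := by
  have h : ∀ n : ℕ, information (bsmsLaw p) Qopt n / ((n : ℝ) + 1) =
      H (mParam p D) - H D + (1 - H (mParam p D)) * (1 / ((n : ℝ) + 1)) := fun n => by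
    rw [information_optimal]
    field_simp
    ring
  simp only [h]
  simpa using (tendsto_one_div_add_atTop_nhds_zero_nat.const_mul
    (1 - H (mParam p D))).const_add (H (mParam p D) - H D)

end Optimal

/-! ### The limit of the normalized rate distortion functions, and the theorem. -/

lemma hasNonanticipativeRate_bsms {p D : ℝ} (hp0 : 0 ≤ p) (hp1 : p ≤ 1) (hD : 0 ≤ D) :
    HasNonanticipativeRate (bsmsLaw p) hamming D
      (if D ≤ 1 / 2 then H (mParam p D) - H D else 0) := by
  have hup : ∃ Q : CausalKernel (Fin 2) (Fin 2),
      (∀ n, avgDistortion (bsmsLaw p) hamming Q n ≤ D) ∧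
      Filter.Tendsto (fun n : ℕ => information (bsmsLaw p) Q n / ((n : ℝ) + 1)) Filter.atTop
        (nhds (if D ≤ 1 / 2 then H (mParam p D) - H D else 0)) := by
    split_ifs with h
    · exact ⟨optimalCausalKernel hp0 hp1 hD h,
        fun n => (avgDistortion_optimal hp0 hp1 hD h n).le,
        tendsto_information_optimal hp0 hp1 hD h⟩
    -- For `D > 1/2` the kernel built for distortion `1/2` is admissible and has rate zero.
    · refine ⟨optimalCausalKernel hp0 hp1 one_half_pos.le le_rfl, fun n => ?_, ?_⟩
      · rw [avgDistortion_optimal]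
        exact (not_le.1 h).le
      · have hlim := tendsto_information_optimal hp0 hp1 one_half_pos.le (le_refl (1 / 2 : ℝ))
        rwa [rate_half p] at hlim
  obtain ⟨Q, hQ, hlim⟩ := hup
  refine tendsto_order.2 ⟨fun a ha => ?_, fun a ha => ?_⟩
  -- An infimum preserves only weak inequalities, so a real `r` strictly between `a` and the limit
  -- is inserted.
  · obtain ⟨r, har, hr⟩ := EReal.lt_iff_exists_real_btwn.1 ha
    obtain ⟨δ, hδ, hev⟩ := exists_eventually_lt_information hp0 hp1 hD (EReal.coe_lt_coe_iff.1 hr)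
    filter_upwards [hev] with n hn
    refine har.trans_le ?_
    have hn0 : (0 : ℝ) < (n : ℝ) + 1 := by positivity
    rw [EReal.le_div_iff_mul_le (by exact_mod_cast hn0) (EReal.coe_ne_top _)]
    refine le_iInf₂ fun Q' hQ' => ?_
    rw [← EReal.coe_mul, EReal.coe_le_coe_iff]
    exact ((lt_div_iff₀ hn0).1 (hn Q' (le_trans hQ' hδ.le))).le
  · have h := (continuous_coe_real_ereal.tendsto _).comp hlim
    filter_upwards [h.eventually (gt_mem_nhds ha)] with n hn
    refine lt_of_le_of_lt ?_ hn
    have hn0 : (0 : ℝ) ≤ (n : ℝ) + 1 := by positivity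
    rw [Function.comp_apply, EReal.coe_div]
    exact EReal.div_le_div_right_of_nonneg (by exact_mod_cast hn0) (iInf₂_le Q (hQ n))

end NRDF

end

theorem mainTheorem4 (p D : ℝ) (hp0 : 0 ≤ p) (hp1 : p ≤ 1) (hD : 0 ≤ D) :
    NRDF.HasNonanticipativeRate (NRDF.bsmsLaw p) NRDF.hamming D
      (if D ≤ 1 / 2 then NRDF.H (NRDF.mParam p D) - NRDF.H D else 0) ∧
    (D ≤ 1 / 2 →
      ∃ Q : NRDF.CausalKernel (Fin 2) (Fin 2),
        -- the kernels: the stationary initial kernel at time 0, and `Q*` at all later times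
        (∀ (y : Fin 0 → Fin 2) (x : Fin 1 → Fin 2) (b : Fin 2),
          Q.prob 0 y x b = if b = x 0 then 1 - D else D) ∧
        (∀ (i : ℕ) (y : Fin (i + 1) → Fin 2) (x : Fin (i + 2) → Fin 2) (b : Fin 2),
          Q.prob (i + 1) y x b =
            NRDF.optimalKernel p D (y (Fin.last i)) (x (Fin.last (i + 1))) b) ∧
        -- the pair of source and reproduction is jointly stationary
        NRDF.JointlyStationary (NRDF.bsmsLaw p) Q ∧
        -- admissibility: the average distortion is `D` at every horizon
        (∀ n : ℕ, NRDF.avgDistortion (NRDF.bsmsLaw p) NRDF.hamming Q n = D) ∧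
        -- optimality: the rate of `Q` is `R^{na}(D)`, and no admissible rate is below it
        Filter.Tendsto (fun n : ℕ => NRDF.information (NRDF.bsmsLaw p) Q n / ((n : ℝ) + 1))
          Filter.atTop (nhds (NRDF.H (NRDF.mParam p D) - NRDF.H D)) ∧
        (∀ Q' ∈ NRDF.fidelitySetInfinite (NRDF.bsmsLaw p) NRDF.hamming D,
          ∀ r < NRDF.H (NRDF.mParam p D) - NRDF.H D, ∀ᶠ n : ℕ in Filter.atTop,
            r < NRDF.information (NRDF.bsmsLaw p) Q' n / ((n : ℝ) + 1)) ∧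
        -- the reproduction process is first-order Markov with the transition law of the source
        (∀ (n : ℕ) (y : Fin (n + 2) → Fin 2),
          NRDF.reproductionLaw (NRDF.bsmsLaw p) Q (n + 1) y =
            NRDF.reproductionLaw (NRDF.bsmsLaw p) Q n (fun j => y j.castSucc) *
              NRDF.bsmsTransition p (y (Fin.last n).castSucc) (y (Fin.last (n + 1))))) := by
  refine ⟨NRDF.hasNonanticipativeRate_bsms hp0 hp1 hD, fun hD1 =>
    ⟨NRDF.optimalCausalKernel hp0 hp1 hD hD1, fun _ _ _ => rfl, fun _ _ _ _ => rfl,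
      NRDF.jointlyStationary_optimal hp0 hp1 hD hD1,
      NRDF.avgDistortion_optimal hp0 hp1 hD hD1,
      NRDF.tendsto_information_optimal hp0 hp1 hD hD1, ?_, ?_⟩⟩
  · rintro Q' ⟨d, hd, hlim⟩ r hr
    -- The average distortion may exceed `D` at finite horizons; the slack `δ > D` absorbs this
    -- eventually.
    obtain ⟨δ, hδ, hev⟩ := NRDF.exists_eventually_lt_information hp0 hp1 hD
      (r := r) (by rwa [if_pos hD1])
    filter_upwards [hev, hlim.eventually (gt_mem_nhds (hd.trans_lt hδ))] with n hn hn'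
    exact hn Q' hn'.le
  · intro n y
    induction y using Fin.snocCases with
    | snoc y b =>
    simp [NRDF.reproductionLaw_optimal, NRDF.bsmsLaw_snoc]
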